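/- For a prime power $q$ let $\Gamma(3,q)$ be the Cayley graph of $(\mathbb F_q,+)$ with connection set $\{x^3 : x\in\mathbb F_q^*\}$, and let $\mathrm{Spec}$ denote the multiset of eigenvalues of the adjacency matrix. For a prime $p\equiv 1\pmod 3$, $m\ge 1$ and integers $a,b$ put $n=\frac{p^{3m}-1}{3}$ and $$S_{m}(a,b)=\Big\{[n]^1,\ \big[\tfrac{a p^{m}-1}{3}\big]^{n},\ \big[\tfrac{-\frac12(a+9b)p^{m}-1}{3}\big]^{n},\ \big[\tfrac{-\frac12(a-9b)p^{m}-1}{3}\big]^{n}\Big\}.$$ **Theorem.** Let $p\equiv 1\pmod 3$ be a prime, let $t\ge 1$ be the minimal positive integer such that $p^t=X^2+27Y^2$ has an integral solution with $(X,p)=1$, and let $0\le s<t$. Then the spectrum of $\Gamma(3,p^{3(t\ell+s)})$, for every $\ell\ge 1$, is determined by the spectra of $\Gamma(3,p^{3t})$ and (if $s\ge1$) $\Gamma(3,p^{3s})$, explicitly as follows. 1. There are integers $x_0,y_0$ with $$p^t=x_0^2+27y_0^2,\qquad x_0\equiv 1 \pmod 3,\qquad (x_0,p)=1,\tag{i}$$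 and integers $a_0,b_0$ with $$4p^s=a_0^2+27b_0^2,\qquad a_0\equiv 1\pmod 3,\qquad (a_0,p)=1.\tag{ii}$$ These can be read off from the two given spectra: integers $x_0,y_0$ satisfy (i) if and only if $\mathrm{Spec}\,\Gamma(3,p^{3t})=S_t(-2x_0,-2y_0)$. If $s\ge 1$, integers $a_0,b_0$ satisfy (ii) if and only if $\mathrm{Spec}\,\Gamma(3,p^{3s})=S_s(a_0,b_0)$. If $s=0$, the only solution of (ii) is $(a_0,b_0)=(-2,0)$. 2. For any $x_0,y_0,a_0,b_0$ as in (i) and (ii), at least one of $a_0x_0-27b_0y_0$ and $a_0x_0+27b_0y_0$ is prime to $p$. So, after replacing $b_0$ by $-b_0$ if necessary, $(a_0x_0-27b_0y_0,\,p)=1$. 3. For any $x_0,y_0,a_0,b_0$ as in (i) and (ii) with $(a_0x_0-27b_0y_0,p)=1$, define integers $a_\ell=a_{\ell,s}$, $b_\ell=b_{\ell,s}$ for $\ell\ge0$ by the initial values $a_0,b_0$ and $$a_{\ell+1}=x_0a_\ell-27y_0b_\ell,\qquad b_{\ell+1}=x_0b_\ell+y_0a_\ell .$$ Then for every $\ell\ge1$: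 $$4p^{t\ell+s}=a_\ell^2+27b_\ell^2,\qquad a_\ell\equiv1\pmod 3,\qquad (a_\ell,p)=1,$$ $$\mathrm{Spec}\,\Gamma(3,p^{3(t\ell+s)})=S_{t\ell+s}(a_\ell,b_\ell),$$ $$a_{\ell+1}=2x_0a_\ell-p^ta_{\ell-1},\qquad b_{\ell+1}=2x_0b_\ell-p^tb_{\ell-1},$$ $$a_\ell=\tfrac12(a_0+3\sqrt3\,b_0i)(x_0+3\sqrt3\,y_0i)^\ell+\tfrac12(a_0-3\sqrt3\,b_0i)(x_0-3\sqrt3\,y_0i)^\ell,$$ $$b_\ell=\tfrac12\big(b_0-\tfrac{\sqrt3}{9}a_0i\big)(x_0+3\sqrt3\,y_0i)^\ell+\tfrac12\big(b_0+\tfrac{\sqrt3}{9}a_0i\big)(x_0-3\sqrt3\,y_0i)^\ell .$$ -/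

import Mathlib

/-- The Cayley digraph `X(G, S)`: there is an arrow from `v` to `w` iff `w - v ∈ S`. -/
def cayleyDigraph {G : Type*} [AddGroup G] (S : Set G) : Digraph G where
  Adj v w := w - v ∈ S

/-- The set of nonzero `k`-th powers of a field. -/
def powerSet (k : ℕ) (F : Type*) [Field F] : Set F :=
  {y | ∃ x : F, x ≠ 0 ∧ y = x ^ k}

/-- The generalized Paley graph: the Cayley graph of the additive group of `F` with connection set
the nonzero `k`-th powers. -/
def gpGraph (k : ℕ) (F : Type*) [Field F] : Digraph F :=
  cayleyDigraph (powerSet k F)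

open Classical in
/-- The spectrum of a finite (di)graph: the multiset of complex eigenvalues of its `0/1` adjacency
matrix, with algebraic multiplicity, i.e. the roots of the characteristic polynomial. -/
noncomputable def graphSpec {V : Type*} [Finite V] (G : Digraph V) : Multiset ℂ :=
  letI : Fintype V := Fintype.ofFinite V
  (Matrix.of fun v w : V => if G.Adj v w then (1 : ℂ) else 0).charpoly.roots

/-- The spectrum of `Γ(3, p ^ (3 * m))`; used for `m ≥ 1`, when `GaloisField p (3 * m)` is the
field with `p ^ (3 * m)` elements. -/
noncomputable def specGamma3 (p : ℕ) [Fact p.Prime] (m : ℕ) : Multiset ℂ :=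
  graphSpec (gpGraph 3 (GaloisField p (3 * m)))

/-- The multiset
`{[n]^1, [(a p^m - 1)/3]^n, [(-(a + 9b)/2 p^m - 1)/3]^n, [(-(a - 9b)/2 p^m - 1)/3]^n}`
with `n = (p^(3m) - 1)/3` (an exact division when `p ≡ 1 (mod 3)`). -/
noncomputable def cubicSpec (p m : ℕ) (a b : ℤ) : Multiset ℂ :=
  {(((p ^ (3 * m) - 1) / 3 : ℕ) : ℂ)}
    + Multiset.replicate ((p ^ (3 * m) - 1) / 3) (((a : ℂ) * (p : ℂ) ^ m - 1) / 3)
    + Multiset.replicate ((p ^ (3 * m) - 1) / 3)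
        ((-(1 / 2 : ℂ) * ((a : ℂ) + 9 * (b : ℂ)) * (p : ℂ) ^ m - 1) / 3)
    + Multiset.replicate ((p ^ (3 * m) - 1) / 3)
        ((-(1 / 2 : ℂ) * ((a : ℂ) - 9 * (b : ℂ)) * (p : ℂ) ^ m - 1) / 3)

/-- `4 p^m = a² + 27 b²` with `a ≡ 1 (mod 3)` and `a` prime to `p`. -/
def IsCubicParam (p m : ℕ) (a b : ℤ) : Prop :=
  4 * (p : ℤ) ^ m = a ^ 2 + 27 * b ^ 2 ∧ a ≡ 1 [ZMOD 3] ∧ IsCoprime a (p : ℤ)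

/-- `p^t = x² + 27 y²` with `x ≡ 1 (mod 3)` and `x` prime to `p`. -/
def IsBaseSol (p t : ℕ) (x y : ℤ) : Prop :=
  (p : ℤ) ^ t = x ^ 2 + 27 * y ^ 2 ∧ x ≡ 1 [ZMOD 3] ∧ IsCoprime x (p : ℤ)

/-- The sequence of pairs `(a_ℓ, b_ℓ)` with initial value `(a₀, b₀)` and
`a_{ℓ+1} = x₀ a_ℓ - 27 y₀ b_ℓ`, `b_{ℓ+1} = x₀ b_ℓ + y₀ a_ℓ`. -/
def paramSeq (x₀ y₀ a₀ b₀ : ℤ) : ℕ → ℤ × ℤ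
  | 0 => (a₀, b₀)
  | l + 1 =>
    (x₀ * (paramSeq x₀ y₀ a₀ b₀ l).1 - 27 * y₀ * (paramSeq x₀ y₀ a₀ b₀ l).2,
      x₀ * (paramSeq x₀ y₀ a₀ b₀ l).2 + y₀ * (paramSeq x₀ y₀ a₀ b₀ l).1)

/-! The core is `specGamma3_eq_cubicSpec_iff`: for m ≥ 1 the spectrum is `cubicSpec p m a b` exactly
when (a, b) is a cubic parameter. The rest is arithmetic of the norm form a² + 27b².

Put q = p^(3m) = 3n + 1. The eigenvalues are the sums of ψ(cx) over nonzero cubes x, and 3λ + 1 is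
the sum of ψ(cx³) over all x. Besides the value at c = 0, only three values u, v, w occur, each n
times. They are integers because every nonzero element of the prime field is a cube. Orthogonality
turns the power moments of 3λ + 1 into numbers of solutions of x³ + y³ = 0 and x³ + y³ + z³ = 0. The
first two moments give an equation X² + 27Y² = 4q. The third is needed only modulo p: the number of
solutions is a product of binomial coefficients, prime to p by Lucas, so q divides the product of
the three numbers 3λ + 1 exactly. This forces X = ap^m and Y = bp^m with a prime to p.

Parameters are unique up to the sign of b (`IsCubicParam.unique`), and `cubicSpec` ignores that sign
and determines its parameter (`IsCubicParam.of_cubicSpec_eq`). Finally, the recursion multiplies a +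
3b√-3 by x₀ + 3y₀√-3, so it multiplies norms by p^t. -/

/-! ### Arithmetic of 4p^m = a² + 27b² -/

/-- A base solution is the same as a cubic parameter with both entries even, up to the factor
`-2`. -/
theorem isBaseSol_iff_isCubicParam {p t : ℕ} (h2 : IsCoprime (2 : ℤ) p) (x y : ℤ) :
    IsBaseSol p t x y ↔ IsCubicParam p t (-2 * x) (-2 * y) := by
  unfold IsBaseSol IsCubicParam
  refine and_congr ⟨fun h => by linear_combination 4 * h, fun h => by linarith⟩
    (and_congr ?_ ?_)
  · simp only [Int.ModEq]; omega
  · rw [IsCoprime.mul_left_iff]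
    exact ⟨fun h => ⟨h2.neg_left, h⟩, fun h => h.2⟩

theorem Int.isCoprime_natCast_prime_iff {p : ℕ} (hp : p.Prime) (a : ℤ) :
    IsCoprime a (p : ℤ) ↔ ¬ (p : ℤ) ∣ a := by
  rw [isCoprime_comm]
  exact (Nat.prime_iff_prime_int.mp hp).coprime_iff_not_dvd

/-- Cubic parameters are unique up to the sign of the second entry. -/
theorem IsCubicParam.unique {p m : ℕ} (hp : p.Prime) (hp7 : 7 ≤ p) {a b a' b' : ℤ}
    (h : IsCubicParam p m a b) (h' : IsCubicParam p m a' b') :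
    a = a' ∧ (b = b' ∨ b = -b') := by
  obtain ⟨h1, h2, h3⟩ := h
  obtain ⟨h1', h2', h3'⟩ := h'
  have hpI : Prime (p : ℤ) := Nat.prime_iff_prime_int.mp hp
  rw [Int.isCoprime_natCast_prime_iff hp] at h3 h3'
  have hpos : (0 : ℤ) < (p : ℤ) ^ m := by have := hp.pos; positivity
  have hp2 : ¬ (p : ℤ) ∣ 2 := fun h => by have := Int.le_of_dvd (by norm_num) h; omega
  -- Brahmagupta's identity for the product of the two norms: a nonzero multiple of p^m in the
  -- second slot would contribute at least 27p^(2m), more than the total 16p^(2m). Hence aB = a'b.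
  have key : ∀ B : ℤ, B ^ 2 = b' ^ 2 → (p : ℤ) ^ m ∣ a * B - a' * b → b ^ 2 = b' ^ 2 := by
    rintro B hB ⟨k, hk⟩
    have hN : (a * a' + 27 * b * B) ^ 2 + 27 * (a * B - a' * b) ^ 2 = 16 * ((p : ℤ) ^ m) ^ 2 := by
      linear_combination (-(27 * b'^2) - a'^2) * h1 - (4 * (p : ℤ) ^ m) * h1'
        + 27 * (a ^ 2 + 27 * b ^ 2) * hB
    have hk0 : k = 0 := by
      by_contra hk0
      have : 1 ≤ k ^ 2 := by have := sq_pos_of_ne_zero hk0; omega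
      rw [hk] at hN
      nlinarith [sq_nonneg (a * a' + 27 * b * B), sq_nonneg ((p : ℤ) ^ m), pow_pos hpos 2]
    rw [hk0, mul_zero] at hk
    have : (p : ℤ) ^ m * (b' ^ 2 - b ^ 2) = 0 := by
      have h4 : (a * B) ^ 2 = (a' * b) ^ 2 := by rw [sub_eq_zero.mp hk]
      have : 4 * ((p : ℤ) ^ m * (b' ^ 2 - b ^ 2)) = 0 := by
        linear_combination h4 + b' ^ 2 * h1 - b ^ 2 * h1' - a ^ 2 * hB
      omega
    rcases mul_eq_zero.mp this with h | h
    · exact absurd h hpos.ne'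
    · linarith
  have hb : b ^ 2 = b' ^ 2 := by
    rcases Nat.eq_zero_or_pos m with rfl | hm
    · exact key b' rfl (by simp)
    -- p cannot divide both factors, since it would then divide b' and so a'. Thus p^m divides one
    -- of them, and B = ±b' in `key` covers both.
    have hprod : (p : ℤ) ^ m ∣ (a * b' - a' * b) * (a * b' + a' * b) :=
      ⟨4 * (b' ^ 2 - b ^ 2), by linear_combination b ^ 2 * h1' - b' ^ 2 * h1⟩
    by_cases hd : (p : ℤ) ∣ a * b' - a' * b
    · have hd' : ¬ (p : ℤ) ∣ a * b' + a' * b := by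
        intro hd'
        have h5 : (p : ℤ) ∣ 2 * a * b' := by
          have := dvd_add hd hd'
          rwa [show a * b' - a' * b + (a * b' + a' * b) = 2 * a * b' by ring] at this
        have h6 : (p : ℤ) ∣ b' := by
          rcases hpI.dvd_or_dvd h5 with h | h
          · rcases hpI.dvd_or_dvd h with h | h
            · exact absurd h hp2
            · exact absurd h h3
          · exact h
        apply h3'
        apply hpI.dvd_of_dvd_pow (n := 2)
        have h7 : a' ^ 2 = 4 * (p : ℤ) ^ m - 27 * b' ^ 2 := by linarith
        rw [h7]
        exact dvd_sub (Dvd.dvd.mul_left (dvd_pow_self _ hm.ne') _)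
          (Dvd.dvd.mul_left (dvd_pow h6 two_ne_zero) _)
      refine key b' rfl (IsCoprime.dvd_of_dvd_mul_right ?_ hprod)
      exact IsCoprime.pow_left ((hpI.coprime_iff_not_dvd).mpr hd')
    · have := IsCoprime.dvd_of_dvd_mul_left
        (IsCoprime.pow_left (m := m) ((hpI.coprime_iff_not_dvd).mpr hd)) hprod
      refine key (-b') (by ring) ?_
      rw [show a * -b' - a' * b = -(a * b' + a' * b) by ring]
      exact (dvd_neg).mpr this
  have ha : a ^ 2 = a' ^ 2 := by linarith
  refine ⟨?_, sq_eq_sq_iff_eq_or_eq_neg.mp hb⟩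
  rcases sq_eq_sq_iff_eq_or_eq_neg.mp ha with h | h
  · exact h
  · simp only [Int.ModEq] at h2 h2'; omega

/-- If `x² + 27 y² = 4 p^(3m)` and `p^(3m)` divides the associated trinomial exactly, then `p^m`
divides `x` and `y` exactly. -/
theorem exists_isCubicParam_of_norm {p m : ℕ} (hp : p.Prime) (hp7 : 7 ≤ p)
    (hm : 1 ≤ m) {x y A : ℤ} (hx3 : x ≡ 1 [ZMOD 3]) (hp3 : (p : ℤ) ≡ 1 [ZMOD 3])
    (h1 : x ^ 2 + 27 * y ^ 2 = 4 * (p : ℤ) ^ (3 * m))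
    (h2 : x * (x ^ 2 - 81 * y ^ 2) = 4 * ((p : ℤ) ^ (3 * m) * A)) (hA : ¬ (p : ℤ) ∣ A) :
    ∃ a b : ℤ, IsCubicParam p m a b ∧ x = a * (p : ℤ) ^ m ∧ y = b * (p : ℤ) ^ m := by
  have hpI : Prime (p : ℤ) := Nat.prime_iff_prime_int.mp hp
  have hp0 : (p : ℤ) ≠ 0 := hpI.ne_zero
  have hp27 : ¬ (p : ℤ) ∣ 27 := by
    intro h
    have h3 : (p : ℤ) ∣ 3 := hpI.dvd_of_dvd_pow (n := 3) (by norm_num; exact h)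
    have := Int.le_of_dvd (by norm_num) h3
    omega
  -- Descent: eliminating y turns the trinomial into the cubic x³ - 3p^(3m)x. While j < m, positive
  -- powers of p survive in both equations and force p to divide a and then b.
  have step : ∀ j, j ≤ m → ∃ a b : ℤ, x = a * (p : ℤ) ^ j ∧ y = b * (p : ℤ) ^ j := by
    intro j
    induction j with
    | zero => exact fun _ => ⟨x, y, by simp, by simp⟩
    | succ j ih =>
      intro hj
      obtain ⟨a, b, rfl, rfl⟩ := ih (by omega)
      obtain ⟨d, rfl⟩ : ∃ d, m = j + 1 + d := ⟨m - (j + 1), by omega⟩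
      have e1 : a ^ 2 + 27 * b ^ 2 = 4 * (p : ℤ) ^ (j + 3 + 3 * d) := by
        have : ((p : ℤ) ^ j) ^ 2 ≠ 0 := by positivity
        apply mul_left_cancel₀ this
        linear_combination h1 + 4 * (by ring : (p : ℤ) ^ (3 * (j + 1 + d)) =
          ((p : ℤ) ^ j) ^ 2 * (p : ℤ) ^ (j + 3 + 3 * d))
      have e2 : a * (a ^ 2 - 3 * (p : ℤ) ^ (j + 3 + 3 * d)) = (p : ℤ) ^ (3 + 3 * d) * A := by
        have : 4 * ((p : ℤ) ^ j) ^ 3 ≠ 0 := by positivity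
        apply mul_left_cancel₀ this
        linear_combination h2 + 3 * a * ((p : ℤ) ^ j) ^ 3 * e1 + 4 * A *
          (by ring : (p : ℤ) ^ (3 * (j + 1 + d)) = ((p : ℤ) ^ j) ^ 3 * (p : ℤ) ^ (3 + 3 * d))
      have da : (p : ℤ) ∣ a := by
        have : (p : ℤ) ∣ a * (a ^ 2 - 3 * (p : ℤ) ^ (j + 3 + 3 * d)) := by
          rw [e2]; exact Dvd.dvd.mul_right (dvd_pow_self _ (by omega)) _
        rcases hpI.dvd_or_dvd this with h | h
        · exact h
        · apply hpI.dvd_of_dvd_pow (n := 2)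
          exact (dvd_sub_left (Dvd.dvd.mul_left (dvd_pow_self _ (by omega)) _)).mp h
      have db : (p : ℤ) ∣ b := by
        have h27 : (p : ℤ) ∣ 27 * b ^ 2 := by
          rw [show 27 * b ^ 2 = 4 * (p : ℤ) ^ (j + 3 + 3 * d) - a ^ 2 by linarith]
          exact dvd_sub (Dvd.dvd.mul_left (dvd_pow_self _ (by omega)) _) (dvd_pow da two_ne_zero)
        rcases hpI.dvd_or_dvd h27 with h | h
        · exact absurd h hp27
        · exact hpI.dvd_of_dvd_pow h
      obtain ⟨a', rfl⟩ := da
      obtain ⟨b', rfl⟩ := db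
      exact ⟨a', b', by ring, by ring⟩
  obtain ⟨a, b, rfl, rfl⟩ := step m le_rfl
  have e1 : a ^ 2 + 27 * b ^ 2 = 4 * (p : ℤ) ^ m := by
    have : ((p : ℤ) ^ m) ^ 2 ≠ 0 := by positivity
    apply mul_left_cancel₀ this
    linear_combination h1 + 4 * (by ring : (p : ℤ) ^ (3 * m) = ((p : ℤ) ^ m) ^ 2 * (p : ℤ) ^ m)
  have e2 : a * (a ^ 2 - 3 * (p : ℤ) ^ m) = A := by
    have : 4 * ((p : ℤ) ^ m) ^ 3 ≠ 0 := by positivity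
    apply mul_left_cancel₀ this
    linear_combination h2 + 3 * a * ((p : ℤ) ^ m) ^ 3 * e1 + 4 * A *
      (by ring : (p : ℤ) ^ (3 * m) = ((p : ℤ) ^ m) ^ 3)
  refine ⟨a, b, ⟨e1.symm, ?_, ?_⟩, rfl, rfl⟩
  · have : a * (p : ℤ) ^ m ≡ a * 1 ^ m [ZMOD 3] := (hp3.pow m).mul_left a
    rw [one_pow, mul_one] at this
    exact this.symm.trans hx3
  · rw [Int.isCoprime_natCast_prime_iff hp]
    exact fun h => hA (e2 ▸ Dvd.dvd.mul_right h _)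

/-- Three integers whose first moments are those of the cubic Gauss periods of the field with
`p^(3m)` elements come from a cubic parameter, provided that the last two are multiples of `3`. -/
theorem exists_isCubicParam_of_moments {p m : ℕ} (hp : p.Prime) (hp3 : p ≡ 1 [MOD 3])
    (hm : 1 ≤ m) {u v w A : ℤ} (hv : (3 : ℤ) ∣ v) (hw : (3 : ℤ) ∣ w)
    (h1 : u + v + w = -1)
    (h2 : (3 * u + 1) ^ 2 + (3 * v + 1) ^ 2 + (3 * w + 1) ^ 2 = 6 * (p : ℤ) ^ (3 * m))
    (h3 : (3 * u + 1) * (3 * v + 1) * (3 * w + 1) = (p : ℤ) ^ (3 * m) * A)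
    (hA : ¬ (p : ℤ) ∣ A) :
    ∃ a b : ℤ, IsCubicParam p m a b ∧ 3 * u + 1 = a * (p : ℤ) ^ m ∧
      2 * (3 * v + 1) = -(a + 9 * b) * (p : ℤ) ^ m ∧
      2 * (3 * w + 1) = -(a - 9 * b) * (p : ℤ) ^ m := by
  have hp7 : 7 ≤ p := by
    have := hp.two_le
    have h4 : p ≠ 4 := by rintro rfl; revert hp; decide
    simp only [Nat.ModEq] at hp3; omega
  obtain ⟨v, rfl⟩ := hv
  obtain ⟨w, rfl⟩ := hw
  obtain rfl : u = -1 - 3 * v - 3 * w := by linarith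
  -- The three numbers 3u + 1, 3v + 1, 3w + 1 (with the original v, w) have sum 0, so they are X,
  -- (-X - 9Y)/2, (-X + 9Y)/2; Y is an integer because v and w were multiples of 3.
  obtain ⟨a, b, hab, ha, hb⟩ := exists_isCubicParam_of_norm (p := p) (m := m) (A := A)
    (x := 3 * (-1 - 3 * v - 3 * w) + 1) (y := w - v) hp hp7 hm
    (by simp only [Int.ModEq]; omega) (by simp only [Int.ModEq, Nat.ModEq] at *; omega)
    (by linarith) (by linear_combination 4 * h3) hA
  exact ⟨a, b, hab, ha, by linear_combination -ha - 9 * hb, by linear_combination -ha + 9 * hb⟩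

/-- The moments give u² + v² + w² ≡ 1 (mod 3), and nonzero squares are 1 modulo 3, so exactly one of
the three is not divisible by 3. -/
theorem exists_two_dvd_of_moments {Q u v w : ℤ} (hQ : Q ≡ 1 [ZMOD 9]) (h1 : u + v + w = -1)
    (h2 : (3 * u + 1) ^ 2 + (3 * v + 1) ^ 2 + (3 * w + 1) ^ 2 = 6 * Q) :
    ((3 : ℤ) ∣ v ∧ (3 : ℤ) ∣ w) ∨ ((3 : ℤ) ∣ u ∧ (3 : ℤ) ∣ w) ∨ ((3 : ℤ) ∣ u ∧ (3 : ℤ) ∣ v) := by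
  obtain ⟨k, hk⟩ := hQ.symm.dvd
  have hs : u ^ 2 + v ^ 2 + w ^ 2 = 1 + 3 * (2 * k) := by linarith
  have hm : (u ^ 2 + v ^ 2 + w ^ 2) % 3 = 1 := by omega
  simp only [Int.dvd_iff_emod_eq_zero]
  rcases (by omega : u % 3 = 0 ∨ u % 3 = 1 ∨ u % 3 = 2) with hu | hu | hu <;>
  rcases (by omega : v % 3 = 0 ∨ v % 3 = 1 ∨ v % 3 = 2) with hv | hv | hv <;>
  rcases (by omega : w % 3 = 0 ∨ w % 3 = 1 ∨ w % 3 = 2) with hw | hw | hw <;>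
  first
  | omega
  | (simp [Int.add_emod, pow_two, Int.mul_emod, hu, hv, hw] at hm)

/-! ### Eigenvalues as character sums -/

open Classical in
/-- The spectrum of a Cayley graph on the additive group of a finite field: the eigenvalues are the
character sums over the connection set. -/
theorem graphSpec_cayleyDigraph {F : Type*} [Field F] [Fintype F] {ψ : AddChar F ℂ}
    (hψ : ψ.IsPrimitive) (S : Set F) :
    graphSpec (cayleyDigraph S) =
      (Finset.univ : Finset F).val.map fun c => ∑ x with x ∈ S, ψ (c * x) := by
  have hcharpoly : ∀ A P D P' : Matrix F F ℂ, A * P = P * D → P * P' = 1 →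
      A.charpoly = D.charpoly := by
    intro A P D P' h1 h2
    have h3 : P' * P = 1 := mul_eq_one_comm.mp h2
    rw [← mul_one A, ← h2, ← mul_assoc, h1, Matrix.charpoly_mul_comm, ← mul_assoc, h3, one_mul]
  unfold graphSpec
  rw [Subsingleton.elim (Fintype.ofFinite F) ‹Fintype F›]
  -- The characters x ↦ ψ(cx) are eigenvectors; orthogonality, from primitivity of ψ, supplies the
  -- inverse matrix.
  rw [hcharpoly _ (Matrix.of fun x c => ψ (c * x))
    (Matrix.diagonal fun c => ∑ x with x ∈ S, ψ (c * x))
    (Matrix.of fun c x => (Fintype.card F : ℂ)⁻¹ * ψ (-(c * x)))]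
  · rw [Matrix.charpoly_diagonal, ← Polynomial.roots_multiset_prod_X_sub_C (Multiset.map _ _),
      Multiset.map_map]
    rfl
  · ext v c
    rw [Matrix.mul_diagonal, Matrix.mul_apply, Finset.mul_sum]
    trans ∑ w, if w - v ∈ S then ψ (c * w) else 0
    · refine Finset.sum_congr rfl fun w _ => ?_
      by_cases h : w - v ∈ S <;> simp [cayleyDigraph, h]
    simp only [Matrix.of_apply, ← AddChar.map_add_eq_mul]
    rw [← Finset.sum_filter]
    refine Finset.sum_nbij' (fun w => w - v) (fun x => x + v) ?_ ?_ ?_ ?_ ?_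
    · simp
    · simp
    · simp
    · simp
    · intro w _
      congr 1
      ring
  · ext v w
    rw [Matrix.mul_apply]
    simp only [Matrix.of_apply]
    have : ∀ c, ψ (c * v) * ((Fintype.card F : ℂ)⁻¹ * ψ (-(c * w))) =
        (Fintype.card F : ℂ)⁻¹ * ψ (c * (v - w)) := by
      intro c
      rw [mul_left_comm, ← AddChar.map_add_eq_mul]
      congr 2
      ring
    simp only [this]
    rw [← Finset.mul_sum, AddChar.sum_mulShift _ hψ, Matrix.one_apply]
    by_cases h : v = w
    · simp [h]
    · simp [h, sub_eq_zero]

/-! ### Cubes in a field with 3n + 1 elements -/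

/-- In a field with `N + 1` elements there is a nonzero element whose first `N` powers run through
all nonzero elements. -/
theorem exists_univ_val_eq_map_pow (F : Type*) [Field F] [Fintype F] {N : ℕ}
    (hF : Fintype.card F = N + 1) :
    ∃ g : F, g ≠ 0 ∧ orderOf g = N ∧
      (Finset.univ : Finset F).val = 0 ::ₘ (Multiset.range N).map (g ^ ·) := by
  classical
  obtain ⟨g, hg⟩ := IsCyclic.exists_generator (α := Fˣ)
  have hord : orderOf g = N := by
    rw [orderOf_eq_card_of_forall_mem_zpowers hg, Nat.card_eq_fintype_card, Fintype.card_units, hF]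
    rfl
  have hord' : orderOf (g : F) = N := by rw [orderOf_units, hord]
  refine ⟨g, g.ne_zero, hord', ?_⟩
  have hinj : Set.InjOn (fun k => (g : F) ^ k) (Finset.range N) := by
    intro i hi j hj hij
    rw [Finset.coe_range] at hi hj
    exact pow_injOn_Iio_orderOf (hord' ▸ hi) (hord' ▸ hj) hij
  have h0 : (0 : F) ∉ (Finset.range N).image fun k => (g : F) ^ k := by simp
  have huniv : (Finset.univ : Finset F) =
      Finset.cons 0 ((Finset.range N).image fun k => (g : F) ^ k) h0 := by
    symm
    apply Finset.eq_univ_of_card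
    rw [Finset.card_cons, Finset.card_image_of_injOn hinj, Finset.card_range, hF]
  rw [huniv, Finset.cons_val, Finset.image_val_of_injOn hinj]
  rfl

theorem Multiset.map_range_three_mul {α : Type*} (h : ℕ → α) (hh : ∀ k, h (k + 3) = h k) (n : ℕ) :
    (Multiset.range (3 * n)).map h =
      replicate n (h 0) + replicate n (h 1) + replicate n (h 2) := by
  have hk : ∀ n k, h (3 * n + k) = h k := by
    intro n k
    induction n with
    | zero => simp
    | succ n ih => rw [← ih, ← hh (3 * n + k)]; congr 1; ring
  induction n with
  | zero => simp
  | succ n ih =>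
    rw [show 3 * (n + 1) = 3 * n + 1 + 1 + 1 by ring]
    simp only [Multiset.range_succ, Multiset.map_cons, ih, Multiset.replicate_succ]
    rw [add_assoc (3 * n) 1 1, hk, hk, show h (3 * n) = h 0 from hk n 0]
    simp only [← Multiset.singleton_add]
    abel

/-- The values of a function on a finite field that is invariant under multiplication by nonzero
cubes. -/
theorem exists_map_univ_eq_replicate (F : Type*) [Field F] [Fintype F] {n : ℕ}
    (hF : Fintype.card F = 3 * n + 1) {α : Type*} (f : F → α)
    (hf : ∀ c y, y ≠ 0 → f (c * y ^ 3) = f c) :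
    ∃ c₁ c₂ c₃ : F, (Finset.univ : Finset F).val.map f =
      {f 0} + Multiset.replicate n (f c₁) + Multiset.replicate n (f c₂)
        + Multiset.replicate n (f c₃) := by
  obtain ⟨g, hg, -, hu⟩ := exists_univ_val_eq_map_pow F hF
  refine ⟨g ^ 0, g ^ 1, g ^ 2, ?_⟩
  rw [hu, Multiset.map_cons, Multiset.map_map,
    Multiset.map_range_three_mul _ (fun k => by simp only [Function.comp, pow_add, hf _ _ hg])]
  simp only [← Multiset.singleton_add, Function.comp]
  abel

/-- The elements killed by raising to the power `n` are cubes when the multiplicative group has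
order `3n`. -/
theorem exists_eq_cube_of_pow_eq_one (F : Type*) [Field F] [Fintype F] {n : ℕ}
    (hF : Fintype.card F = 3 * n + 1) {x : F} (hx : x ^ n = 1) (hn : 0 < n) :
    ∃ y, y ≠ 0 ∧ x = y ^ 3 := by
  obtain ⟨g, hg, hord, hu⟩ := exists_univ_val_eq_map_pow F hF
  have hx0 : x ≠ 0 := by rintro rfl; simp [hn.ne'] at hx
  have : x ∈ (Finset.univ : Finset F).val := Finset.mem_univ x
  rw [hu, Multiset.mem_cons, Multiset.mem_map] at this
  obtain h | ⟨k, -, rfl⟩ := this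
  · exact absurd h hx0
  · rw [← pow_mul, ← orderOf_dvd_iff_pow_eq_one, hord] at hx
    obtain ⟨j, rfl⟩ := Nat.dvd_of_mul_dvd_mul_right hn hx
    exact ⟨g ^ j, pow_ne_zero _ hg, by rw [← pow_mul, mul_comm]⟩

/-- In a field with `3n + 1` elements a nonzero cube has three cube roots. -/
theorem card_cube_eq_cube (F : Type*) [Field F] [Fintype F] [DecidableEq F] {n : ℕ}
    (hF : Fintype.card F = 3 * n + 1) (hn : 0 < n) {y : F} (hy : y ≠ 0) :
    (Finset.univ.filter fun x : F => x ^ 3 = y ^ 3).card = 3 := by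
  obtain ⟨g, hg, hord, -⟩ := exists_univ_val_eq_map_pow F hF
  have hprim : IsPrimitiveRoot (g ^ n) 3 :=
    (hord ▸ IsPrimitiveRoot.orderOf g).pow (by omega) (by ring)
  have h1 := hprim.card_nthRoots (y ^ 3)
  rw [if_pos ⟨y, rfl⟩] at h1
  refine Eq.trans ?_ h1
  rw [← Multiset.toFinset_card_of_nodup (hprim.nthRoots_nodup (pow_ne_zero 3 hy))]
  refine congrArg Finset.card ?_
  ext x
  simp [Polynomial.mem_nthRoots]

open Classical in
/-- Summing over all cubes with multiplicity. -/
theorem sum_cube {F : Type*} [Field F] [Fintype F] {n : ℕ}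
    (hF : Fintype.card F = 3 * n + 1) (hn : 0 < n) (f : F → ℂ) :
    ∑ x, f (x ^ 3) = f 0 + 3 * ∑ x with x ∈ powerSet 3 F, f x := by
  rw [← Finset.add_sum_erase _ _ (Finset.mem_univ (0 : F)), zero_pow three_ne_zero]
  congr 1
  rw [← Finset.sum_fiberwise_of_maps_to (s := Finset.univ.erase (0 : F))
    (t := Finset.univ.filter fun x => x ∈ powerSet 3 F) (g := fun x => x ^ 3), Finset.mul_sum]
  · refine Finset.sum_congr rfl fun y hy => ?_
    obtain ⟨z, hz, rfl⟩ := (Finset.mem_filter.mp hy).2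
    rw [Finset.sum_congr rfl (g := fun _ => f (z ^ 3))
      (fun x hx => by rw [(Finset.mem_filter.mp hx).2]), Finset.sum_const, nsmul_eq_mul]
    congr 1
    refine Eq.trans (congrArg Nat.cast ?_) Nat.cast_ofNat
    refine Eq.trans (congrArg Finset.card ?_) (card_cube_eq_cube F hF hn hz)
    ext x
    simp only [Finset.mem_filter, Finset.mem_erase, Finset.mem_univ, and_true, true_and,
      and_iff_right_iff_imp]
    rintro h rfl
    exact pow_ne_zero 3 hz (by rw [← h]; simp)
  · intro x hx
    exact Finset.mem_filter.mpr ⟨Finset.mem_univ _, x, Finset.ne_of_mem_erase hx, rfl⟩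

/-! ### Counting zeros of sums of cubes -/

/-- The number of solutions of `x³ + y³ = 0`. -/
theorem card_sum_two_cubes (F : Type*) [Field F] [Fintype F] [DecidableEq F] {n : ℕ}
    (hF : Fintype.card F = 3 * n + 1) (hn : 0 < n) :
    (Finset.univ.filter fun v : F × F => v.1 ^ 3 + v.2 ^ 3 = 0).card = 9 * n + 1 := by
  have h0 : ∀ y : F, (Finset.univ.filter fun x : F => x ^ 3 + y ^ 3 = 0).card =
      if y = 0 then 1 else 3 := by
    intro y
    split_ifs with hy
    · rw [Finset.card_eq_one]
      exact ⟨0, by ext x; simp [hy]⟩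
    · refine Eq.trans (congrArg Finset.card ?_) (card_cube_eq_cube F hF hn (neg_ne_zero.mpr hy))
      ext x
      simp only [Finset.mem_filter, Finset.mem_univ, true_and]
      rw [add_eq_zero_iff_eq_neg]
      rw [Odd.neg_pow (by decide)]
  rw [Finset.card_filter, Fintype.sum_prod_type_right]
  simp only [← Finset.card_filter, h0]
  rw [← Finset.add_sum_erase _ _ (Finset.mem_univ (0 : F)), if_pos rfl,
    Finset.sum_congr rfl (g := fun _ => 3) (fun x hx => if_neg (Finset.ne_of_mem_erase hx))]
  simp [hF]
  ring

/-- Power sums of shifted cubes over a field with `3n + 1` elements. -/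
theorem sum_cube_add_pow (F : Type*) [Field F] [Fintype F] {n : ℕ}
    (hF : Fintype.card F = 3 * n + 1) (hn : 0 < n) (k : ℕ) (w : F) :
    ∑ x : F, (x ^ 3 + w) ^ (k * n) =
      -∑ j ∈ Finset.Icc 1 k, w ^ ((k - j) * n) * ((k * n).choose (j * n) : F) := by
  classical
  -- Only exponents divisible by 3n survive; i = 0 gives the cardinality of `F`, which is zero in
  -- `F`.
  have hs : ∀ i, ∑ x : F, (x ^ 3) ^ i = if 0 < i ∧ n ∣ i then -1 else 0 := by
    intro i
    rcases Nat.eq_zero_or_pos i with rfl | hi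
    · simp
    · simp only [← pow_mul, hi, true_and]
      have h1 := FiniteField.sum_pow_units F (3 * i)
      simp only [hF, Nat.add_sub_cancel, Nat.mul_dvd_mul_iff_left (show 0 < 3 by norm_num)] at h1
      rw [← h1, ← Finset.add_sum_erase _ _ (Finset.mem_univ (0 : F)), zero_pow (by omega), zero_add]
      symm
      refine Finset.sum_bij (fun u _ => (u : F)) (by simp) (by simp [Units.ext_iff]) ?_ (by simp)
      exact fun x hx => ⟨Units.mk0 x (Finset.ne_of_mem_erase hx), by simp⟩
  simp only [add_pow]
  rw [Finset.sum_comm]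
  simp only [mul_assoc, ← Finset.sum_mul, hs, ite_mul, neg_mul, one_mul, zero_mul]
  rw [← Finset.sum_filter, ← Finset.sum_neg_distrib]
  symm
  refine Finset.sum_bij (fun j _ => j * n) ?_ ?_ ?_ ?_
  · intro j hj
    rw [Finset.mem_Icc] at hj
    rw [Finset.mem_filter, Finset.mem_range, Nat.lt_succ_iff]
    exact ⟨Nat.mul_le_mul_right n hj.2, Nat.mul_pos hj.1 hn, Dvd.intro_left j rfl⟩
  · intro i _ j _ h
    exact Nat.eq_of_mul_eq_mul_right hn h
  · intro i hi
    obtain ⟨h1, h2, j, rfl⟩ := Finset.mem_filter.mp hi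
    rw [Finset.mem_range, Nat.lt_succ_iff, mul_comm n] at h1
    refine ⟨j, Finset.mem_Icc.mpr ⟨Nat.pos_of_mul_pos_left h2, Nat.le_of_mul_le_mul_right h1 hn⟩,
      mul_comm _ _⟩
  · intro j _
    rw [Nat.sub_mul]

/-- The number of solutions of `x³ + y³ + z³ = 0`, modulo the characteristic. -/
theorem card_sum_three_cubes (F : Type*) [Field F] [Fintype F] [DecidableEq F] {n : ℕ}
    (hF : Fintype.card F = 3 * n + 1) (hn : 0 < n) :
    ((Finset.univ.filter fun v : F × F × F => v.1 ^ 3 + v.2.1 ^ 3 + v.2.2 ^ 3 = 0).card : F) =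
      (((3 * n).choose n * (2 * n).choose n : ℕ) : F) := by
  have hcard : (Fintype.card F : F) = 0 := FiniteField.cast_card_eq_zero F
  -- Chevalley–Warning indicator of zero. Summing over one variable at a time leaves only the
  -- coefficient of (xyz)^(3n) in (x³ + y³ + z³)^(3n).
  have h1 : ∀ u : F, (if u = 0 then (1 : F) else 0) = 1 - u ^ (3 * n) := by
    intro u
    split_ifs with hu
    · simp [hu, hn.ne']
    · have := FiniteField.pow_card_sub_one_eq_one u hu
      rw [hF, Nat.add_sub_cancel] at this
      rw [this, sub_self]
  have hI2 : Finset.Icc 1 2 = {1, 2} := rfl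
  have hI3 : Finset.Icc 1 3 = {1, 2, 3} := rfl
  have s1 := fun w : F => sum_cube_add_pow F hF hn 1 w
  have s2 := fun w : F => sum_cube_add_pow F hF hn 2 w
  have s3 := fun w : F => sum_cube_add_pow F hF hn 3 w
  simp [hI2, hI3] at s1 s2 s3
  have s0 : ∑ z : F, (z ^ 3) ^ n = -1 := by simpa using s1 0
  rw [Finset.card_filter]
  push_cast
  simp only [h1, Fintype.sum_prod_type_right]
  simp only [add_assoc, Finset.sum_sub_distrib, s3, Finset.sum_neg_distrib, Finset.sum_add_distrib,
    ← Finset.sum_mul, s2, s1, s0]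
  simp [hcard, mul_comm]

/-! ### Cubic Gauss sums: moments and integrality -/

/-- The cubic analogue of a quadratic Gauss sum, without multiplicative characters. -/
noncomputable def cubicGaussSum {F : Type*} [Field F] [Fintype F] (ψ : AddChar F ℂ) (c : F) : ℂ :=
  ∑ x, ψ (c * x ^ 3)

section

variable {F : Type*} [Field F] [Fintype F]

/-- Makes the sum constant on each coset of the nonzero cubes, hence at most three values for c ≠ 0.
-/
theorem cubicGaussSum_mul_cube (ψ : AddChar F ℂ) (c : F) {y : F} (hy : y ≠ 0) :
    cubicGaussSum ψ (c * y ^ 3) = cubicGaussSum ψ c := by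
  unfold cubicGaussSum
  refine Fintype.sum_equiv (Equiv.mulLeft₀ y hy) _ _ fun x => ?_
  change ψ (c * y ^ 3 * x ^ 3) = ψ (c * (y * x) ^ 3)
  congr 1
  ring

theorem cubicGaussSum_zero (ψ : AddChar F ℂ) : cubicGaussSum ψ 0 = Fintype.card F := by
  simp [cubicGaussSum]

open Classical in
theorem cubicGaussSum_eq {n : ℕ} (hF : Fintype.card F = 3 * n + 1) (hn : 0 < n)
    (ψ : AddChar F ℂ) (c : F) :
    cubicGaussSum ψ c = 1 + 3 * ∑ x with x ∈ powerSet 3 F, ψ (c * x) := by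
  unfold cubicGaussSum
  rw [sum_cube hF hn (fun x => ψ (c * x))]
  simp

theorem sum_cubicGaussSum {n : ℕ} (hF : Fintype.card F = 3 * n + 1) {ψ : AddChar F ℂ}
    (hψ : ψ.IsPrimitive) : ∑ c, cubicGaussSum ψ c = 3 * n + 1 := by
  classical
  unfold cubicGaussSum
  rw [Finset.sum_comm]
  simp only [AddChar.sum_mulShift _ hψ]
  simp [hF]

/-- Expanding the square and summing over c first gives, by orthogonality, `Fintype.card F` times
the number of zeros of x³ + y³. The third moment works the same way with three cubes. -/
theorem sum_cubicGaussSum_sq {n : ℕ} (hF : Fintype.card F = 3 * n + 1) (hn : 0 < n)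
    {ψ : AddChar F ℂ} (hψ : ψ.IsPrimitive) :
    ∑ c, cubicGaussSum ψ c ^ 2 = (3 * n + 1) * (9 * n + 1) := by
  classical
  have h : ∀ c, cubicGaussSum ψ c ^ 2 = ∑ v : F × F, ψ (c * (v.1 ^ 3 + v.2 ^ 3)) := by
    intro c
    simp only [cubicGaussSum, pow_two, Finset.sum_mul_sum, Fintype.sum_prod_type, mul_add,
      AddChar.map_add_eq_mul]
  simp only [h]
  rw [Finset.sum_comm]
  simp only [AddChar.sum_mulShift _ hψ]
  push_cast
  rw [← Finset.sum_filter, Finset.sum_const, card_sum_two_cubes F hF hn, hF]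
  push_cast
  ring

open Classical in
theorem sum_cubicGaussSum_cube {n : ℕ} (hF : Fintype.card F = 3 * n + 1)
    {ψ : AddChar F ℂ} (hψ : ψ.IsPrimitive) :
    ∑ c, cubicGaussSum ψ c ^ 3 = (3 * n + 1) *
      (Finset.univ.filter fun v : F × F × F => v.1 ^ 3 + v.2.1 ^ 3 + v.2.2 ^ 3 = 0).card := by
  have h : ∀ c, cubicGaussSum ψ c ^ 3 =
      ∑ v : F × F × F, ψ (c * (v.1 ^ 3 + v.2.1 ^ 3 + v.2.2 ^ 3)) := by
    intro c
    have h3 : cubicGaussSum ψ c ^ 3 = (∑ x, ψ (c * x ^ 3)) *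
        ((∑ x, ψ (c * x ^ 3)) * ∑ x, ψ (c * x ^ 3)) := by
      rw [cubicGaussSum]; ring
    simp only [Fintype.sum_prod_type, mul_add, AddChar.map_add_eq_mul]
    rw [h3, Finset.sum_mul]
    refine Finset.sum_congr rfl fun x _ => ?_
    rw [Finset.sum_mul_sum, Finset.mul_sum]
    refine Finset.sum_congr rfl fun y _ => ?_
    rw [Finset.mul_sum]
    exact Finset.sum_congr rfl fun z _ => (mul_assoc _ _ _).symm
  simp only [h]
  rw [Finset.sum_comm]
  simp only [AddChar.sum_mulShift _ hψ]
  push_cast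
  rw [← Finset.sum_filter, Finset.sum_const, hF]
  push_cast
  ring

theorem AddChar.isIntegral_apply (ψ : AddChar F ℂ) (x : F) : IsIntegral ℤ (ψ x) := by
  refine IsIntegral.of_pow (n := Fintype.card F) Fintype.card_pos ?_
  rw [← AddChar.map_nsmul_eq_pow, card_nsmul_eq_zero, AddChar.map_zero_eq_one]
  exact isIntegral_one

open Classical in
/-- If all scalars from the prime field are cubes, the character sums over the nonzero cubes are
integers. -/
theorem exists_int_eq_sum_cubes {n p : ℕ} (hF : Fintype.card F = 3 * n + 1) (hn : 0 < n)
    (hp : p.Prime) [CharP F p] (hpn : p - 1 ∣ n) (ψ : AddChar F ℂ) (c : F) :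
    ∃ z : ℤ, ∑ x with x ∈ powerSet 3 F, ψ (c * x) = z := by
  have : Fact p.Prime := ⟨hp⟩
  -- Replacing ψ by ψ^k is Galois conjugation; it fixes the sum because k is a cube in `F`.
  have hcube : ∀ k ∈ (Finset.range p).erase 0, ∑ x : F, ψ (c * x ^ 3) ^ k =
      cubicGaussSum ψ c := by
    intro k hk
    rw [Finset.mem_erase, Finset.mem_range] at hk
    have hk0 : (k : ZMod p) ≠ 0 := by
      rw [Ne, ZMod.natCast_eq_zero_iff]
      exact fun h => absurd (Nat.le_of_dvd (Nat.pos_of_ne_zero hk.1) h) (by omega)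
    have hkn : (k : F) ^ n = 1 := by
      obtain ⟨d, rfl⟩ := hpn
      have h1 := ZMod.pow_card_sub_one_eq_one hk0
      have h2 := congrArg (ZMod.castHom (dvd_refl p) F) h1
      simp only [map_pow, map_natCast, map_one] at h2
      rw [pow_mul, h2, one_pow]
    obtain ⟨y, hy, hky⟩ := exists_eq_cube_of_pow_eq_one F hF hkn hn
    rw [← cubicGaussSum_mul_cube ψ c hy, cubicGaussSum]
    refine Finset.sum_congr rfl fun x _ => ?_
    rw [← AddChar.map_nsmul_eq_pow, nsmul_eq_mul, hky]
    congr 1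
    ring
  have hgeom : ∀ x : F, ∑ k ∈ (Finset.range p).erase 0, ψ x ^ k =
      (((if ψ x = 1 then (p : ℤ) else 0) - 1 : ℤ) : ℂ) := by
    intro x
    have hmem : 0 ∈ Finset.range p := Finset.mem_range.mpr hp.pos
    have h1 := Finset.add_sum_erase _ (fun k => ψ x ^ k) hmem
    rw [pow_zero] at h1
    rw [← eq_sub_iff_add_eq'] at h1
    rw [h1]
    push_cast
    congr 1
    split_ifs with hx
    · simp [hx]
    · have hxp : ψ x ^ p = 1 := by
        rw [← AddChar.map_nsmul_eq_pow, nsmul_eq_mul, CharP.cast_eq_zero, zero_mul,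
          AddChar.map_zero_eq_one]
      rw [geom_sum_eq hx, hxp, sub_self, zero_div]
  -- Averaging over the p - 1 conjugates shows that the sum is rational; being an algebraic integer,
  -- the eigenvalue is then an integer.
  have hrat : ((p : ℂ) - 1) * cubicGaussSum ψ c =
      ((∑ x : F, ((if ψ (c * x ^ 3) = 1 then (p : ℤ) else 0) - 1) : ℤ) : ℂ) := by
    rw [Int.cast_sum, ← Finset.sum_congr rfl (fun x _ => hgeom (c * x ^ 3)), Finset.sum_comm,
      Finset.sum_congr rfl hcube, Finset.sum_const,
      Finset.card_erase_of_mem (Finset.mem_range.mpr hp.pos), Finset.card_range, nsmul_eq_mul,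
      Nat.cast_sub hp.one_le, Nat.cast_one]
  set Z : ℤ := ∑ x : F, ((if ψ (c * x ^ 3) = 1 then (p : ℤ) else 0) - 1)
  have hint : IsIntegral ℤ (∑ x with x ∈ powerSet 3 F, ψ (c * x)) :=
    IsIntegral.sum _ fun x _ => AddChar.isIntegral_apply ψ _
  have hp1 : (p : ℂ) - 1 ≠ 0 := by
    rw [sub_ne_zero]
    exact_mod_cast hp.one_lt.ne'
  have heq : ∑ x with x ∈ powerSet 3 F, ψ (c * x) =
      algebraMap ℚ ℂ (((Z : ℚ) / ((p : ℚ) - 1) - 1) / 3) := by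
    rw [cubicGaussSum_eq hF hn] at hrat
    simp only [eq_ratCast]
    push_cast
    rw [← hrat]
    field_simp
    ring
  rw [heq] at hint ⊢
  rw [isIntegral_algebraMap_iff (algebraMap ℚ ℂ).injective] at hint
  obtain ⟨z, hz⟩ := IsIntegrallyClosed.isIntegral_iff.mp hint
  exact ⟨z, by rw [← hz]; simp⟩

end

/-! ### Nondivisibility by p and the spectrum -/

/-- By Lucas' theorem, `p` does not divide `(i n).choose n` for `i = 1, 2, 3` and
`n = (p ^ M - 1) / 3`, whose digits are all equal to `(p - 1) / 3`. -/
theorem Nat.Prime.not_dvd_mul_choose {p d : ℕ} (hp : p.Prime) (hd : p = 3 * d + 1) {i : ℕ}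
    (hi1 : 1 ≤ i) (hi : i ≤ 3) (M n : ℕ) (hn : p ^ M = 3 * n + 1) :
    ¬ p ∣ (i * n).choose n := by
  have : Fact p.Prime := ⟨hp⟩
  have hid : i * d < p := by nlinarith
  have hd' : d < p := by omega
  have hbase : ¬ p ∣ (i * d).choose d := by
    intro h
    have h1 := Nat.choose_mul_factorial_mul_factorial (Nat.le_mul_of_pos_left d hi1)
    have h2 : p ∣ (i * d).factorial := h1 ▸ Dvd.dvd.mul_right (Dvd.dvd.mul_right h _) _
    exact absurd (hp.dvd_factorial.mp h2) (by omega)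
  induction M generalizing n with
  | zero =>
    obtain rfl : n = 0 := by simpa using hn
    simpa using hp.one_lt.ne'
  | succ M ih =>
    obtain ⟨k, hk⟩ : ∃ k, p ^ M = 3 * k + 1 := by
      have h1 : p ^ M ≡ 1 ^ M [MOD 3] := Nat.ModEq.pow M (by rw [hd]; simp [Nat.ModEq])
      rw [one_pow] at h1
      exact ⟨p ^ M / 3, by simp only [Nat.ModEq] at h1; omega⟩
    -- Peels off the lowest base-p digit d of n; since id < p, multiplication by i causes no carry.
    obtain rfl : n = d + p * k := by
      rw [pow_succ, hk] at hn
      nlinarith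
    intro h
    have hluc := Choose.choose_modEq_choose_mod_mul_choose_div_nat (p := p)
      (n := i * (d + p * k)) (k := d + p * k)
    rw [show i * (d + p * k) = i * d + p * (i * k) by ring, Nat.add_mul_mod_self_left,
      Nat.add_mul_mod_self_left, Nat.add_mul_div_left _ _ hp.pos, Nat.add_mul_div_left _ _ hp.pos,
      Nat.mod_eq_of_lt hid, Nat.mod_eq_of_lt hd', Nat.div_eq_of_lt hid, Nat.div_eq_of_lt hd',
      zero_add, zero_add] at hluc
    rw [show i * (d + p * k) = i * d + p * (i * k) by ring] at h
    rcases hp.dvd_mul.mp ((hluc.dvd_iff dvd_rfl).mp h) with h | h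
    · exact hbase h
    · exact ih k hk h

open Classical in
/-- The spectrum of the cubic Paley graph is described by some cubic parameter. -/
theorem exists_specGamma3_eq_cubicSpec {p : ℕ} [Fact p.Prime] (hp3 : p ≡ 1 [MOD 3]) {m : ℕ}
    (hm : 1 ≤ m) : ∃ a b : ℤ, IsCubicParam p m a b ∧ specGamma3 p m = cubicSpec p m a b := by
  have hp : p.Prime := Fact.out
  obtain ⟨d, hd⟩ : ∃ d, p = 3 * d + 1 := by
    have := hp.two_le
    exact ⟨p / 3, by simp only [Nat.ModEq] at hp3; omega⟩
  obtain ⟨e, he⟩ : p ^ 3 - 1 ∣ p ^ (3 * m) - 1 := by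
    simpa [pow_mul] using Nat.sub_dvd_pow_sub_pow (p ^ 3) 1 m
  obtain ⟨n, hn, hpn⟩ : ∃ n, p ^ (3 * m) = 3 * n + 1 ∧ p - 1 ∣ n := by
    have h1 : 1 ≤ p ^ (3 * m) := Nat.one_le_pow _ _ hp.pos
    -- p² + p + 1 is divisible by 3, so p - 1 still divides n after the division by 3. This is where
    -- an extension degree divisible by 3 enters.
    have h2 : p ^ 3 - 1 = 3 * ((p - 1) * (3 * d ^ 2 + 3 * d + 1)) := by
      rw [hd, Nat.add_sub_cancel]
      refine Nat.sub_eq_of_eq_add ?_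
      ring
    refine ⟨(p - 1) * (3 * d ^ 2 + 3 * d + 1) * e, ?_, ?_⟩
    · rw [h2, mul_assoc] at he
      omega
    · rw [mul_assoc]; exact Dvd.intro _ rfl
  have hn0 : 0 < n := by
    have : 1 < p ^ (3 * m) := Nat.one_lt_pow (by omega) hp.one_lt
    omega
  let F := GaloisField p (3 * m)
  let _ : Fintype F := Fintype.ofFinite F
  have hF : Fintype.card F = 3 * n + 1 := by
    rw [← hn, ← Nat.card_eq_fintype_card]
    exact GaloisField.card p (3 * m) (by omega)
  obtain ⟨ψ, hψ⟩ : ∃ ψ : AddChar F ℂ, ψ.IsPrimitive :=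
    ⟨_, AddChar.FiniteField.primitiveChar_to_Complex_isPrimitive F⟩
  choose lam hlam using exists_int_eq_sum_cubes hF hn0 hp hpn ψ
  have hu : ∀ c, cubicGaussSum ψ c = ((3 * lam c + 1 : ℤ) : ℂ) := by
    intro c
    rw [cubicGaussSum_eq hF hn0, hlam]
    push_cast
    ring
  have hlam0 : lam 0 = n := by
    have h1 := hu 0
    rw [cubicGaussSum_zero, hF] at h1
    have h2 : ((3 * n + 1 : ℕ) : ℤ) = 3 * lam 0 + 1 := by exact_mod_cast h1
    push_cast at h2
    linarith
  obtain ⟨c₁, c₂, c₃, hmul⟩ := exists_map_univ_eq_replicate F hF lam fun c y hy => by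
    have h1 := cubicGaussSum_mul_cube ψ c hy
    rw [hu, hu, Int.cast_inj] at h1
    linarith
  rw [hlam0] at hmul
  have hsum : ∀ k : ℕ, ∑ c, (3 * lam c + 1) ^ k = (3 * n + 1 : ℤ) ^ k +
      n * (3 * lam c₁ + 1) ^ k + n * (3 * lam c₂ + 1) ^ k + n * (3 * lam c₃ + 1) ^ k := by
    intro k
    have h1 := congrArg (fun s => (s.map fun z : ℤ => (3 * z + 1) ^ k).sum) hmul
    simpa [add_assoc] using h1
  generalize lam c₁ = u at hmul hsum
  generalize lam c₂ = v at hmul hsum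
  generalize lam c₃ = w at hmul hsum
  have hnZ : (n : ℤ) ≠ 0 := by exact_mod_cast hn0.ne'
  have m1 : u + v + w = -1 := by
    have h1 := sum_cubicGaussSum hF hψ
    simp only [hu] at h1
    have h2 : ∑ c, (3 * lam c + 1) = (3 * n + 1 : ℤ) := by exact_mod_cast h1
    have h3 := hsum 1
    simp only [pow_one] at h3
    rw [h2] at h3
    have h4 : (n : ℤ) * (3 * (u + v + w + 1)) = 0 := by linear_combination -h3
    have := (mul_eq_zero.mp h4).resolve_left hnZ
    omega
  have m2 : (3 * u + 1) ^ 2 + (3 * v + 1) ^ 2 + (3 * w + 1) ^ 2 = 6 * (p : ℤ) ^ (3 * m) := by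
    have h1 := sum_cubicGaussSum_sq hF hn0 hψ
    simp only [hu] at h1
    have h2 : ∑ c, (3 * lam c + 1) ^ 2 = ((3 * n + 1) * (9 * n + 1) : ℤ) := by exact_mod_cast h1
    have h3 := hsum 2
    rw [h2] at h3
    have hnZ' : (p : ℤ) ^ (3 * m) = 3 * n + 1 := by exact_mod_cast hn
    rw [hnZ']
    apply mul_left_cancel₀ hnZ
    linear_combination -h3
  obtain ⟨A, m3, hA⟩ : ∃ A : ℤ, (3 * u + 1) * (3 * v + 1) * (3 * w + 1) =
      (p : ℤ) ^ (3 * m) * A ∧ ¬ (p : ℤ) ∣ A := by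
    have h1 := sum_cubicGaussSum_cube hF hψ
    have hN := card_sum_three_cubes F hF hn0
    set N := (Finset.univ.filter fun v : F × F × F => v.1 ^ 3 + v.2.1 ^ 3 + v.2.2 ^ 3 = 0).card
    simp only [hu] at h1
    have h2 : ∑ c, (3 * lam c + 1) ^ 3 = ((3 * n + 1) * N : ℤ) := by exact_mod_cast h1
    have h3 := hsum 3
    rw [h2] at h3
    have hnZ' : (p : ℤ) ^ (3 * m) = 3 * n + 1 := by exact_mod_cast hn
    -- Three numbers with sum 0 have cubes summing to three times their product P, so the third
    -- moment reads q³ + (q - 1)P = qN. The cofactor P - N + q² is then congruent to -N modulo p.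
    have hprod : (3 * u + 1) * (3 * v + 1) * (3 * w + 1) = (p : ℤ) ^ (3 * m) *
        ((3 * u + 1) * (3 * v + 1) * (3 * w + 1) - N + (3 * n + 1) ^ 2) := by
      rw [hnZ']
      obtain rfl : u = -1 - v - w := by linarith
      linear_combination h3
    refine ⟨_, hprod, fun hdvd => ?_⟩
    have hpq : (p : ℤ) ∣ (p : ℤ) ^ (3 * m) := dvd_pow_self _ (by omega)
    have hdN : (p : ℤ) ∣ N := by
      have h4 : (p : ℤ) ∣ (3 * u + 1) * (3 * v + 1) * (3 * w + 1) := by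
        rw [hprod]; exact Dvd.dvd.mul_right hpq _
      have h5 : (p : ℤ) ∣ (3 * n + 1) ^ 2 := by
        rw [← hnZ']; exact dvd_pow hpq two_ne_zero
      have h6 := dvd_sub (dvd_add h4 h5) hdvd
      rwa [show (3 * u + 1) * (3 * v + 1) * (3 * w + 1) + (3 * n + 1) ^ 2 -
        ((3 * u + 1) * (3 * v + 1) * (3 * w + 1) - N + (3 * n + 1) ^ 2) = (N : ℤ) by ring] at h6
    rw [Int.natCast_dvd_natCast, ← CharP.cast_eq_zero_iff F p, hN, CharP.cast_eq_zero_iff F p,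
      hp.dvd_mul] at hdN
    rcases hdN with h | h
    · exact hp.not_dvd_mul_choose hd (by norm_num) (by norm_num) _ _ hn h
    · exact hp.not_dvd_mul_choose hd (by norm_num) (by norm_num) _ _ hn h
  have hspec : specGamma3 p m = {(n : ℂ)} + Multiset.replicate n (u : ℂ) +
      Multiset.replicate n (v : ℂ) + Multiset.replicate n (w : ℂ) := by
    have h1 := graphSpec_cayleyDigraph hψ (powerSet 3 F)
    change specGamma3 p m = _ at h1
    rw [h1]
    simp only [hlam]
    have h2 := congrArg (Multiset.map (Int.cast : ℤ → ℂ)) hmul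
    simpa [Multiset.map_map, Function.comp_def] using h2
  have hcubic : ∀ (a b : ℤ) (u v w : ℤ), 3 * u + 1 = a * (p : ℤ) ^ m →
      2 * (3 * v + 1) = -(a + 9 * b) * (p : ℤ) ^ m →
      2 * (3 * w + 1) = -(a - 9 * b) * (p : ℤ) ^ m →
      cubicSpec p m a b = {(n : ℂ)} + Multiset.replicate n (u : ℂ) +
        Multiset.replicate n (v : ℂ) + Multiset.replicate n (w : ℂ) := by
    intro a b u v w h1 h2 h3
    have h1' : 3 * (u : ℂ) + 1 = a * (p : ℂ) ^ m := by exact_mod_cast h1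
    have h2' : 2 * (3 * (v : ℂ) + 1) = -(a + 9 * b) * (p : ℂ) ^ m := by exact_mod_cast h2
    have h3' : 2 * (3 * (w : ℂ) + 1) = -(a - 9 * b) * (p : ℂ) ^ m := by exact_mod_cast h3
    have hdiv : (p ^ (3 * m) - 1) / 3 = n := by omega
    unfold cubicSpec
    rw [hdiv]
    congr 3
    · congr 2
      linear_combination -h1' / 3
    · linear_combination -h2' / 6
    · linear_combination -h3' / 6
  have hq9 : (p : ℤ) ^ (3 * m) ≡ 1 [ZMOD 9] := by
    have h1 : (p : ℤ) ^ 3 ≡ 1 [ZMOD 9] := by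
      refine (Int.modEq_iff_dvd.mpr ⟨3 * d ^ 3 + 3 * d ^ 2 + d, ?_⟩).symm
      rw [hd]; push_cast; ring
    simpa [pow_mul] using h1.pow m
  -- The value not divisible by 3 is the one carrying a; the cases differ by a permutation.
  rcases exists_two_dvd_of_moments hq9 m1 m2 with ⟨h1, h2⟩ | ⟨h1, h2⟩ | ⟨h1, h2⟩
  · obtain ⟨a, b, hab, e1, e2, e3⟩ :=
      exists_isCubicParam_of_moments hp hp3 hm h1 h2 m1 m2 m3 hA
    exact ⟨a, b, hab, by rw [hspec, hcubic a b _ _ _ e1 e2 e3]⟩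
  · obtain ⟨a, b, hab, e1, e2, e3⟩ :=
      exists_isCubicParam_of_moments hp hp3 hm (u := v) h1 h2 (by linarith) (by linarith)
        (by linarith) hA
    refine ⟨a, b, hab, ?_⟩
    rw [hspec, hcubic a b _ _ _ e1 e2 e3]
    abel
  · obtain ⟨a, b, hab, e1, e2, e3⟩ :=
      exists_isCubicParam_of_moments hp hp3 hm (u := w) h1 h2 (by linarith) (by linarith)
        (by linarith) hA
    refine ⟨a, b, hab, ?_⟩
    rw [hspec, hcubic a b _ _ _ e1 e2 e3]
    abel

/-! ### Reading the parameter off the spectrum -/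

theorem cubicSpec_neg_right (p m : ℕ) (a b : ℤ) : cubicSpec p m a (-b) = cubicSpec p m a b := by
  unfold cubicSpec
  rw [add_right_comm]
  congr 4 <;> · push_cast; ring

/-- A multiset of the form `cubicSpec p m a b` determines its cubic parameter. -/
theorem IsCubicParam.of_cubicSpec_eq {p m : ℕ} (hp : p.Prime) (hm : 1 ≤ m) (hp4 : 4 ≤ p)
    {a b a' b' : ℤ} (h' : IsCubicParam p m a' b') (h : cubicSpec p m a b = cubicSpec p m a' b') :
    IsCubicParam p m a b := by
  have hn : (p ^ (3 * m) - 1) / 3 ≠ 0 := by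
    have : p ≤ p ^ (3 * m) := Nat.le_self_pow (by omega) p
    omega
  have hP : (p : ℂ) ^ m ≠ 0 := pow_ne_zero _ (by exact_mod_cast hp.ne_zero)
  unfold cubicSpec at h
  generalize (p ^ (3 * m) - 1) / 3 = n at h hn
  have hnC : (n : ℂ) ≠ 0 := by exact_mod_cast hn
  rw [add_assoc, add_assoc, add_assoc, add_assoc, add_right_inj] at h
  have hsq := congrArg (fun s => (s.map fun z : ℂ => ((3 * z + 1) / (p : ℂ) ^ m) ^ 2).sum) h
  have hmem : ((a : ℂ) * (p : ℂ) ^ m - 1) / 3 ∈ Multiset.replicate n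
      (((a : ℂ) * (p : ℂ) ^ m - 1) / 3) + (Multiset.replicate n
        ((-(1 / 2 : ℂ) * ((a : ℂ) + 9 * (b : ℂ)) * (p : ℂ) ^ m - 1) / 3) +
      Multiset.replicate n
        ((-(1 / 2 : ℂ) * ((a : ℂ) - 9 * (b : ℂ)) * (p : ℂ) ^ m - 1) / 3)) := by
    simp [Multiset.mem_replicate, hn]
  rw [h] at hmem
  simp only [Multiset.mem_add, Multiset.mem_replicate, ne_eq, hn, not_false_eq_true,
    true_and] at hmem
  have hval : ∀ z : ℂ, (3 * ((z * (p : ℂ) ^ m - 1) / 3) + 1) / (p : ℂ) ^ m = z := by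
    intro z; field_simp; ring
  simp only [Multiset.map_add, Multiset.map_replicate, Multiset.sum_add, Multiset.sum_replicate,
    hval, ← smul_add] at hsq
  simp only [nsmul_eq_mul] at hsq
  have hsq' : (a : ℂ) ^ 2 + 27 * (b : ℂ) ^ 2 = (a' : ℂ) ^ 2 + 27 * (b' : ℂ) ^ 2 := by
    have := mul_left_cancel₀ hnC hsq
    linear_combination (2 / 3) * this
  have hsqZ : a ^ 2 + 27 * b ^ 2 = a' ^ 2 + 27 * b' ^ 2 := by exact_mod_cast hsq'
  have hinj : ∀ x y : ℂ, (x * (p : ℂ) ^ m - 1) / 3 = (y * (p : ℂ) ^ m - 1) / 3 → x = y := by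
    intro x y hxy
    rw [← hval x, hxy, hval]
  obtain ⟨h1, h2, h3⟩ := h'
  -- If a matched one of the other two values, equality of norms would give (6b)² = (a' - 3B)²,
  -- impossible modulo 3 as a' ≡ 1.
  have hbad : ∀ B : ℤ, B ^ 2 = b' ^ 2 → 2 * a = -(a' + 9 * B) → False := by
    intro B hB ha
    have h4 : (6 * b) ^ 2 = (a' - 3 * B) ^ 2 := by
      have : 3 * (6 * b) ^ 2 = 3 * (a' - 3 * B) ^ 2 := by
        linear_combination 4 * hsqZ - (2 * a - (a' + 9 * B)) * ha - 108 * hB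
      linarith
    simp only [Int.ModEq] at h2
    rcases sq_eq_sq_iff_eq_or_eq_neg.mp h4 with h | h <;> omega
  rcases hmem with h4 | h4 | h4
  · have h5 : a = a' := by exact_mod_cast hinj _ _ h4
    subst h5
    exact ⟨by rw [h1, hsqZ], h2, h3⟩
  · have h5 := hinj _ _ h4
    have h6 : 2 * (a : ℂ) = -(a' + 9 * b') := by rw [h5]; ring
    exact (hbad b' rfl (by exact_mod_cast h6)).elim
  · have h5 := hinj _ _ h4
    have h6 : 2 * (a : ℂ) = -(a' + 9 * (-b')) := by rw [h5]; ring
    exact (hbad (-b') (by ring) (by exact_mod_cast h6)).elim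

theorem specGamma3_eq_cubicSpec_iff {p : ℕ} [Fact p.Prime] (hp3 : p ≡ 1 [MOD 3]) (hp7 : 7 ≤ p)
    {m : ℕ} (hm : 1 ≤ m) (a b : ℤ) :
    specGamma3 p m = cubicSpec p m a b ↔ IsCubicParam p m a b := by
  have hp : p.Prime := Fact.out
  obtain ⟨a', b', h', hs⟩ := exists_specGamma3_eq_cubicSpec hp3 hm
  rw [hs]
  constructor
  · exact fun h => h'.of_cubicSpec_eq hp hm (by omega) h.symm
  · intro h
    obtain ⟨rfl, rfl | rfl⟩ := h'.unique hp hp7 h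
    · rfl
    · exact cubicSpec_neg_right p m _ _

theorem isCubicParam_zero_iff {p : ℕ} (h2 : IsCoprime (2 : ℤ) p) (a b : ℤ) :
    IsCubicParam p 0 a b ↔ a = -2 ∧ b = 0 := by
  constructor
  · rintro ⟨h1, h3, -⟩
    rw [pow_zero, mul_one] at h1
    have hb : b = 0 := by
      by_contra hb
      have := sq_pos_of_ne_zero hb
      nlinarith [sq_nonneg a]
    subst hb
    refine ⟨?_, rfl⟩
    rcases sq_eq_sq_iff_eq_or_eq_neg.mp (show a ^ 2 = 2 ^ 2 by linarith) with rfl | rfl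
    · exact absurd h3 (by decide)
    · rfl
  · rintro ⟨rfl, rfl⟩
    exact ⟨by norm_num, by decide, h2.neg_left⟩

/-! ### The recursive sequence -/

section

variable (x y a b : ℤ)

/-- Each step multiplies a + 3b√-3 by x + 3y√-3, and the norm is multiplicative. -/
theorem paramSeq_norm {N M : ℤ} (h : N = x ^ 2 + 27 * y ^ 2) (h' : 4 * M = a ^ 2 + 27 * b ^ 2)
    (l : ℕ) :
    4 * (N ^ l * M) = (paramSeq x y a b l).1 ^ 2 + 27 * (paramSeq x y a b l).2 ^ 2 := by
  induction l with
  | zero => simpa [paramSeq] using h'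
  | succ l ih =>
    simp only [paramSeq]
    linear_combination N * ih + ((paramSeq x y a b l).1 ^ 2 + 27 * (paramSeq x y a b l).2 ^ 2) * h

theorem paramSeq_fst_modEq (hx : x ≡ 1 [ZMOD 3]) (ha : a ≡ 1 [ZMOD 3]) (l : ℕ) :
    (paramSeq x y a b l).1 ≡ 1 [ZMOD 3] := by
  induction l with
  | zero => exact ha
  | succ l ih =>
    have h1 : x * (paramSeq x y a b l).1 ≡ 1 * 1 [ZMOD 3] := hx.mul ih
    simp only [paramSeq, Int.ModEq, mul_assoc] at *
    omega

/-- The multiplier x + 3y√-3 is a root of T² - 2xT + N. -/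
theorem paramSeq_recurrence {N : ℤ} (h : N = x ^ 2 + 27 * y ^ 2) (l : ℕ) :
    (paramSeq x y a b (l + 2)).1 =
      2 * x * (paramSeq x y a b (l + 1)).1 - N * (paramSeq x y a b l).1 ∧
    (paramSeq x y a b (l + 2)).2 =
      2 * x * (paramSeq x y a b (l + 1)).2 - N * (paramSeq x y a b l).2 := by
  simp only [paramSeq]
  exact ⟨by rw [h]; ring, by rw [h]; ring⟩

theorem paramSeq_closed_form (l : ℕ) :
    ((paramSeq x y a b l).1 : ℂ) =
      1 / 2 * ((a : ℂ) + 3 * (√3 : ℝ) * b * Complex.I)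
          * ((x : ℂ) + 3 * (√3 : ℝ) * y * Complex.I) ^ l
        + 1 / 2 * ((a : ℂ) - 3 * (√3 : ℝ) * b * Complex.I)
          * ((x : ℂ) - 3 * (√3 : ℝ) * y * Complex.I) ^ l ∧
    ((paramSeq x y a b l).2 : ℂ) =
      1 / 2 * ((b : ℂ) - (√3 : ℝ) / 9 * a * Complex.I)
          * ((x : ℂ) + 3 * (√3 : ℝ) * y * Complex.I) ^ l
        + 1 / 2 * ((b : ℂ) + (√3 : ℝ) / 9 * a * Complex.I)
          * ((x : ℂ) - 3 * (√3 : ℝ) * y * Complex.I) ^ l := by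
  have h3 : ((√3 : ℝ) : ℂ) ^ 2 = 3 := by
    rw [← Complex.ofReal_pow, Real.sq_sqrt (by norm_num)]
    norm_num
  have hI := Complex.I_sq
  induction l with
  | zero => constructor <;> · simp only [paramSeq, pow_zero]; ring
  | succ l ih =>
    obtain ⟨ih1, ih2⟩ := ih
    simp only [paramSeq]
    push_cast
    rw [ih1, ih2]
    generalize ((√3 : ℝ) : ℂ) = r at *
    have hrI : r ^ 2 * Complex.I ^ 2 = -3 := by rw [h3, hI]; norm_num
    simp only [pow_succ]
    generalize ((x : ℂ) + 3 * r * y * Complex.I) ^ l = P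
    generalize ((x : ℂ) - 3 * r * y * Complex.I) ^ l = Q
    constructor
    · linear_combination -(9 / 2 * (b : ℂ) * y * (P + Q)) * hrI
    · linear_combination (1 / 6 * (a : ℂ) * y * (P + Q)) * hrI

end

/-! ### Main theorem -/

theorem theorem3p1 (p : ℕ) [Fact p.Prime] (hp : p ≡ 1 [MOD 3]) (t : ℕ)
    (ht : IsLeast {t : ℕ | 0 < t ∧ ∃ x y : ℤ,
      (p : ℤ) ^ t = x ^ 2 + 27 * y ^ 2 ∧ IsCoprime x (p : ℤ)} t)
    (s : ℕ) (hs : s < t) :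
    -- the parameters exist, and can be read off from the two base spectra
    (∃ x₀ y₀ : ℤ, IsBaseSol p t x₀ y₀) ∧
    (∃ a₀ b₀ : ℤ, IsCubicParam p s a₀ b₀) ∧
    (∀ x y : ℤ, specGamma3 p t = cubicSpec p t (-2 * x) (-2 * y) ↔ IsBaseSol p t x y) ∧
    (∀ a b : ℤ, s = 0 → (IsCubicParam p s a b ↔ a = -2 ∧ b = 0)) ∧
    (∀ a b : ℤ, 1 ≤ s → (specGamma3 p s = cubicSpec p s a b ↔ IsCubicParam p s a b)) ∧
    -- the parameters determine all the spectra
    (∀ x₀ y₀ a₀ b₀ : ℤ, IsBaseSol p t x₀ y₀ → IsCubicParam p s a₀ b₀ →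
      -- at least one sign of `b₀` is admissible
      (IsCoprime (a₀ * x₀ - 27 * b₀ * y₀) (p : ℤ) ∨ IsCoprime (a₀ * x₀ + 27 * b₀ * y₀) (p : ℤ)) ∧
      -- and for an admissible sign the following holds
      (IsCoprime (a₀ * x₀ - 27 * b₀ * y₀) (p : ℤ) →
        ∀ a b : ℕ → ℤ,
          (∀ l, a l = (paramSeq x₀ y₀ a₀ b₀ l).1) → (∀ l, b l = (paramSeq x₀ y₀ a₀ b₀ l).2) →
          ∀ l : ℕ, 1 ≤ l →
            IsCubicParam p (t * l + s) (a l) (b l) ∧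
            specGamma3 p (t * l + s) = cubicSpec p (t * l + s) (a l) (b l) ∧
            a (l + 1) = 2 * x₀ * a l - (p : ℤ) ^ t * a (l - 1) ∧
            b (l + 1) = 2 * x₀ * b l - (p : ℤ) ^ t * b (l - 1) ∧
            (a l : ℂ) =
              1 / 2 * ((a₀ : ℂ) + 3 * (√3 : ℝ) * b₀ * Complex.I)
                  * ((x₀ : ℂ) + 3 * (√3 : ℝ) * y₀ * Complex.I) ^ l
                + 1 / 2 * ((a₀ : ℂ) - 3 * (√3 : ℝ) * b₀ * Complex.I)
                  * ((x₀ : ℂ) - 3 * (√3 : ℝ) * y₀ * Complex.I) ^ l ∧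
            (b l : ℂ) =
              1 / 2 * ((b₀ : ℂ) - (√3 : ℝ) / 9 * a₀ * Complex.I)
                  * ((x₀ : ℂ) + 3 * (√3 : ℝ) * y₀ * Complex.I) ^ l
                + 1 / 2 * ((b₀ : ℂ) + (√3 : ℝ) / 9 * a₀ * Complex.I)
                  * ((x₀ : ℂ) - 3 * (√3 : ℝ) * y₀ * Complex.I) ^ l)) := by
  have hpp : p.Prime := Fact.out
  have hp7 : 7 ≤ p := by
    have := hpp.two_le
    have h4 : p ≠ 4 := by rintro rfl; revert hpp; decide
    simp only [Nat.ModEq] at hp; omega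
  have hpI : Prime (p : ℤ) := Nat.prime_iff_prime_int.mp hpp
  have hp2 : ¬ (p : ℤ) ∣ 2 := fun h => by have := Int.le_of_dvd (by norm_num) h; omega
  have h2 : IsCoprime (2 : ℤ) p := (Int.isCoprime_natCast_prime_iff hpp 2).mpr hp2
  obtain ⟨ht0, x, y, hxy, hx⟩ := ht.1
  refine ⟨?_, ?_, ?_, ?_, ?_, ?_⟩
  · have hx3 : x % 3 = 1 ∨ (-x) % 3 = 1 := by
      have h1 : (p : ℤ) ^ t ≡ 1 ^ t [ZMOD 3] := Int.ModEq.pow t (by exact_mod_cast hp)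
      rw [one_pow, hxy, Int.ModEq] at h1
      by_contra hcon
      obtain ⟨k, rfl⟩ : (3 : ℤ) ∣ x := by omega
      ring_nf at h1
      omega
    rcases hx3 with h | h
    · exact ⟨x, y, hxy, h, hx⟩
    · exact ⟨-x, y, by rw [hxy]; ring, h, hx.neg_left⟩
  · rcases Nat.eq_zero_or_pos s with rfl | hs0
    · exact ⟨-2, 0, (isCubicParam_zero_iff h2 _ _).mpr ⟨rfl, rfl⟩⟩
    · obtain ⟨a, b, h, -⟩ := exists_specGamma3_eq_cubicSpec hp hs0
      exact ⟨a, b, h⟩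
  · intro x y
    rw [specGamma3_eq_cubicSpec_iff hp hp7 ht0, isBaseSol_iff_isCubicParam h2]
  · rintro a b rfl
    exact isCubicParam_zero_iff h2 a b
  · exact fun a b h => specGamma3_eq_cubicSpec_iff hp hp7 h a b
  · rintro x₀ y₀ a₀ b₀ ⟨hx1, hx2, hx3⟩ ⟨ha1, ha2, ha3⟩
    have hcop := Int.isCoprime_natCast_prime_iff hpp
    constructor
    · by_contra hcon
      rw [not_or, hcop, hcop, not_not, not_not] at hcon
      have h4 := dvd_add hcon.1 hcon.2
      rw [show a₀ * x₀ - 27 * b₀ * y₀ + (a₀ * x₀ + 27 * b₀ * y₀) = 2 * (a₀ * x₀) by ring] at h4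
      rw [hcop] at hx3 ha3
      rcases hpI.dvd_or_dvd h4 with h | h
      · exact hp2 h
      · rcases hpI.dvd_or_dvd h with h | h
        · exact ha3 h
        · exact hx3 h
    · intro hadm a b ha hb l hl
      obtain ⟨k, rfl⟩ : ∃ k, l = k + 1 := ⟨l - 1, by omega⟩
      -- The choice of sign of b₀ is exactly the case ℓ = 1; afterwards a_(ℓ+1) ≡ 2x₀a_ℓ modulo p,
      -- because t > 0.
      have hcopl : ∀ k, IsCoprime (paramSeq x₀ y₀ a₀ b₀ (k + 1)).1 (p : ℤ) := by
        intro k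
        induction k with
        | zero =>
          simp only [paramSeq]
          convert hadm using 1
          ring
        | succ k ih =>
          rw [(paramSeq_recurrence x₀ y₀ a₀ b₀ hx1 k).1]
          rw [hcop] at ih hx3 ⊢
          intro h
          have h4 := (dvd_sub_left (Dvd.dvd.mul_right (dvd_pow_self _ ht0.ne') _)).mp h
          rcases hpI.dvd_or_dvd h4 with h | h
          · rcases hpI.dvd_or_dvd h with h | h
            · exact hp2 h
            · exact hx3 h
          · exact ih h
      have hparam : IsCubicParam p (t * (k + 1) + s) (a (k + 1)) (b (k + 1)) := by
        rw [ha, hb]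
        refine ⟨?_, paramSeq_fst_modEq _ _ _ _ hx2 ha2 _, hcopl k⟩
        rw [← paramSeq_norm x₀ y₀ a₀ b₀ hx1 ha1 (k + 1), pow_add, pow_mul]
      refine ⟨hparam, (specGamma3_eq_cubicSpec_iff hp hp7 ?_ _ _).mpr hparam, ?_, ?_, ?_, ?_⟩
      · have : 0 < t * (k + 1) := Nat.mul_pos ht0 k.succ_pos
        omega
      · rw [ha, ha, ha]; exact (paramSeq_recurrence x₀ y₀ a₀ b₀ hx1 k).1
      · rw [hb, hb, hb]; exact (paramSeq_recurrence x₀ y₀ a₀ b₀ hx1 k).2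
      · rw [ha]; exact (paramSeq_closed_form x₀ y₀ a₀ b₀ _).1
      · rw [hb]; exact (paramSeq_closed_form x₀ y₀ a₀ b₀ _).2
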